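/- **Setting.** A Markov decision process (MDP) is a tuple $\mathcal M=(S,\mathsf A,\mathsf{Av},\Delta,s_0)$ with finite sets $S$ of states and $\mathsf A$ of actions, a map $\mathsf{Av}$ that assigns to each state a non-empty set of enabled actions such that each action is enabled in exactly one state, a probability distribution $\Delta(a)$ on $S$ for every $a\in\mathsf A$, and an initial state $s_0\in S$. A strategy $\sigma$ consists of a countable set $\mathsf M$ of memory elements, a memory update function that maps $(a,s,m)\in\mathsf A\times S\times\mathsf M$ to a distribution $\sigma_u(a,s,m)$ on $\mathsf M$, a next move function that maps $(s,m)\in S\times\mathsf M$ to a distribution $\sigma_n(s,m)$ on $\mathsf A$ supported in $\mathsf{Av}(s)$, and an initial distribution $\alpha$ on $\mathsf M$. It is memoryless if $\mathsf M$ is a singleton; its next moves may be randomised. It determines a Markov chain on $S\times\mathsf M\times\mathsf A$ with initial distribution $(s_0,m,a)\mapsto\alpha(m)\,\sigma_n(s_0,m)(a)$ and transition probabilities $\Delta(a)(s')\,\sigma_u(a,s',m)(m')\,\sigma_n(s',m')(a')$ from $(s,m,a)$ to $(s',m',a')$. Let $\mathbb P^\sigma$ be the induced probability measure on the sequences $\rho=\rho_1\rho_2\cdots$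 of visited states. For a set $T\subseteq S$ of target states and a reward function $\mathbf r$ with real values, the weighted reachability payoff $R(\rho)$ is $\mathbf r(\rho_i)$ for the least $i$ with $\rho_i\in T$, and $0$ if there is no such $i$. For $p\in(0,1)$ and a real-valued random variable $X$ put $$\mathrm{VaR}_p(X)=\sup\{x\in\mathbb R : \mathbb P[X\le x]\le p\},\qquad \mathrm{CVaR}_p(X)=\frac1p\Big(\mathbb E\big[X\cdot\mathbf 1_{X<x_p}\big]+\big(p-\mathbb P[X<x_p]\big)\,x_p\Big),\quad x_p=\mathrm{VaR}_p(X).$$ A query is given by $T$, $\mathbf r$, thresholds $e,c,v\in\mathbb R\cup\{\bot\}$ and levels $p,q\in(0,1)$. A strategy $\sigma$ is a witness to the query if, with respect to $\mathbb P^\sigma$, $$\mathbb E[R]\ge e,\qquad \mathrm{CVaR}_p(R)\ge c,\qquad \mathrm{VaR}_q(R)\ge v,$$ where a constraint with threshold $\bot$ is trivially satisfied. **Theorem.** Let $\mathcal M$ be an MDP and consider a query with target set $T$ and reward function $\mathbf r$. Suppose that the attraction assumption holds: either $T$ is reached almost surely under every strategy, or $\mathbf r(s)\ge0$ for all $s\in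 T$. If some strategy is a witness to the query, then some memoryless randomising strategy is a witness to the query. -/

import Mathlib

open MeasureTheory ProbabilityTheory

/-! ### Markov chains and their run measures -/

/-- A run: an infinite sequence of states, indexed from `0`. -/
def Run (X : Type*) : Type _ := ℕ → X

/-- The product of the discrete `σ`-fields. For countable `X` it is the `σ`-field generated by
the cones. -/
instance Run.instMeasurableSpace (X : Type*) : MeasurableSpace (Run X) :=
  @MeasurableSpace.pi ℕ (fun _ => X) (fun _ => ⊤)

/-- The cone of all runs that agree with `w` in the positions `0, …, n`. -/
def Run.cone {X : Type*} (w : ℕ → X) (n : ℕ) : Set (Run X) := {ρ | ∀ i ≤ n, ρ i = w i}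

/-- A (time-homogeneous) Markov chain with state set `X`, used here for countable `X`. -/
structure MarkovChain (X : Type*) where
  /-- the initial distribution -/
  init : PMF X
  /-- the transition function -/
  step : X → PMF X

namespace MarkovChain

variable {X : Type*}

/-- The one-step transition kernels, as functions of the path up to time `n`. -/
noncomputable def kernel (C : MarkovChain X) (n : ℕ) :
    @Kernel (Finset.Iic n → X) X (@MeasurableSpace.pi _ (fun _ => X) (fun _ => ⊤)) ⊤ :=
  letI : MeasurableSpace X := ⊤
  { toFun := fun h => (C.step (h ⟨n, Finset.mem_Iic.2 le_rfl⟩)).toMeasure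
    measurable' :=
      (measurable_from_top (f := fun x : X => (C.step x).toMeasure)).comp
        (measurable_pi_apply (⟨n, Finset.mem_Iic.2 le_rfl⟩ : Finset.Iic n)) }

instance (C : MarkovChain X) (n : ℕ) :
    @IsMarkovKernel _ _ (@MeasurableSpace.pi _ (fun _ => X) (fun _ => ⊤)) ⊤ (C.kernel n) :=
  let _ : MeasurableSpace X := ⊤
  ⟨fun _ => PMF.toMeasure.isProbabilityMeasure _⟩

/-- The probability measure on runs: the first state is distributed according to `init`, and each
further state is drawn by `step` from its predecessor. See `law_cone`. -/
noncomputable def law (C : MarkovChain X) : Measure (Run X) :=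
  letI : MeasurableSpace X := ⊤
  Kernel.trajMeasure (X := fun _ : ℕ => X) C.init.toMeasure C.kernel

instance (C : MarkovChain X) : IsProbabilityMeasure C.law :=
  let _ : MeasurableSpace X := ⊤
  inferInstanceAs (IsProbabilityMeasure
    (Kernel.trajMeasure (X := fun _ : ℕ => X) C.init.toMeasure C.kernel))

/-- The probabilities of cones, which determine the measure. -/
theorem law_cone (C : MarkovChain X) (w : ℕ → X) (n : ℕ) :
    C.law (Run.cone w n) = C.init (w 0) * ∏ i ∈ Finset.range n, C.step (w i) (w (i + 1)) := by
  let _ : MeasurableSpace X := ⊤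
  let μ : Measure (ℕ → X) :=
    Kernel.trajMeasure (X := fun _ : ℕ => X) C.init.toMeasure C.kernel
  have hμ : IsProbabilityMeasure μ := inferInstanceAs (IsProbabilityMeasure
    (Kernel.trajMeasure (X := fun _ : ℕ => X) C.init.toMeasure C.kernel))
  have hmeas : ∀ k : ℕ, Measurable (Preorder.frestrictLe (π := fun _ : ℕ => X) k) :=
    fun k => Preorder.measurable_frestrictLe k
  have hiff : ∀ (k : ℕ) (ρ : ℕ → X), Preorder.frestrictLe (π := fun _ : ℕ => X) k ρ =
      Preorder.frestrictLe k w ↔ ∀ i ≤ k, ρ i = w i := by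
    intro k ρ
    simp only [funext_iff, Subtype.forall, Finset.mem_Iic, Preorder.frestrictLe_apply]
  have key : ∀ k, μ (Run.cone w k) =
      μ.map (Preorder.frestrictLe k) {Preorder.frestrictLe (π := fun _ : ℕ => X) k w} := by
    intro k
    rw [Measure.map_apply (hmeas k) (measurableSet_singleton _)]
    congr 1
    ext ρ
    exact (hiff k ρ).symm
  change μ (Run.cone w n) = _
  induction n with
  | zero =>
    rw [key]
    have h0 : μ.map (Preorder.frestrictLe 0) = C.init.toMeasure.map
        (MeasurableEquiv.piUnique (fun _ : Finset.Iic 0 => X)).symm := by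
      change (Kernel.trajMeasure (X := fun _ : ℕ => X) C.init.toMeasure C.kernel).map _ = _
      rw [Kernel.trajMeasure, Measure.map_comp _ _ (hmeas 0), Kernel.traj_map_frestrictLe,
        Kernel.partialTraj_self]
      exact Measure.id_comp
    rw [h0, Measure.map_apply (MeasurableEquiv.measurable _) (measurableSet_singleton _)]
    have : (MeasurableEquiv.piUnique (fun _ : Finset.Iic 0 => X)).symm ⁻¹'
        {Preorder.frestrictLe (π := fun _ : ℕ => X) 0 w} = {w 0} := by
      ext x
      simp only [Set.mem_preimage, Set.mem_singleton_iff]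
      constructor
      · intro h
        exact congrFun h (⟨0, Finset.mem_Iic.2 le_rfl⟩ : Finset.Iic 0)
      · rintro rfl
        funext i
        obtain ⟨i, hi⟩ := i
        obtain rfl : i = 0 := by simpa using hi
        rfl
    rw [this, PMF.toMeasure_apply_singleton _ _ (measurableSet_singleton _)]
    simp
  | succ k ih =>
    have hstep := Kernel.map_frestrictLe_trajMeasure_compProd_eq_map_trajMeasure
      (X := fun _ : ℕ => X) (μ₀ := C.init.toMeasure) (κ := C.kernel) (a := k)
    have hset : Run.cone w (k + 1) = (fun x : ℕ → X => (Preorder.frestrictLe k x, x (k + 1))) ⁻¹'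
        ({Preorder.frestrictLe (π := fun _ : ℕ => X) k w} ×ˢ {w (k + 1)}) := by
      ext ρ
      refine Iff.trans ?_ (and_congr_left' (hiff k ρ)).symm
      change (∀ i ≤ k + 1, ρ i = w i) ↔ (∀ i ≤ k, ρ i = w i) ∧ ρ (k + 1) = w (k + 1)
      constructor
      · exact fun h => ⟨fun i hi => h i (hi.trans k.le_succ), h _ le_rfl⟩
      · rintro ⟨h₁, h₂⟩ i hi
        rcases Nat.le_succ_iff.1 hi with h | rfl
        · exact h₁ i h
        · exact h₂
    have hm : Measurable (fun x : ℕ → X => (Preorder.frestrictLe (π := fun _ : ℕ => X) k x,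
        x (k + 1))) := (hmeas k).prodMk (measurable_pi_apply _)
    rw [hset, ← Measure.map_apply hm
      ((measurableSet_singleton _).prod (measurableSet_singleton _))]
    change ((Kernel.trajMeasure (X := fun _ : ℕ => X) C.init.toMeasure C.kernel).map _) _ = _
    rw [← hstep, Measure.compProd_apply_prod (measurableSet_singleton _)
      (measurableSet_singleton _), lintegral_singleton]
    change (C.step (w k)).toMeasure {w (k + 1)} * (μ.map (Preorder.frestrictLe k)) _ = _
    rw [← key, ih, PMF.toMeasure_apply_singleton _ _ (measurableSet_singleton _),
      Finset.prod_range_succ]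
    ring

end MarkovChain

/-! ### Markov decision processes and strategies -/

/-- A Markov decision process with states `S` and actions `A`. Each action is enabled in exactly
one state. -/
structure MDP (S A : Type*) where
  /-- the actions enabled in a state -/
  Av : S → Set A
  av_nonempty : ∀ s, (Av s).Nonempty
  av_partition : ∀ a, ∃! s, a ∈ Av s
  /-- the distribution over successor states of an action -/
  Δ : A → PMF S
  /-- the initial state -/
  s₀ : S

namespace MDP

variable {S A : Type*}

/-- A strategy: countable memory with stochastic update, randomised next moves and a random
initial memory element. (Every countable set is in bijection with a set in `Type`.) -/
structure Strategy (𝓜 : MDP S A) where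
  /-- the memory elements -/
  Mem : Type
  mem_countable : Countable Mem
  /-- the memory update, given the last action, the new state and the old memory element -/
  update : A → S → Mem → PMF Mem
  /-- the next move -/
  next : S → Mem → PMF A
  /-- the initial memory distribution -/
  start : PMF Mem
  next_support : ∀ s m, (next s m).support ⊆ 𝓜.Av s

namespace Strategy

variable {𝓜 : MDP S A}

/-- A strategy is memoryless if its memory is a singleton. Its next moves may be randomised. -/
def IsMemoryless (σ : 𝓜.Strategy) : Prop := Nonempty (Unique σ.Mem)

/-- The play determined by a strategy, as a Markov chain. In state `(s, m, a)`, the action to be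
performed next is `a`. -/
noncomputable def play (σ : 𝓜.Strategy) : MarkovChain (S × σ.Mem × A) where
  init := σ.start.bind fun m => (σ.next 𝓜.s₀ m).bind fun a => PMF.pure (𝓜.s₀, m, a)
  step := fun x => (𝓜.Δ x.2.2).bind fun s' => (σ.update x.2.2 s' x.2.1).bind fun m' =>
    (σ.next s' m').bind fun a' => PMF.pure (s', m', a')

/-- The probability measure on the sequences of visited states. -/
noncomputable def prob (σ : 𝓜.Strategy) : Measure (Run S) :=
  σ.play.law.map (fun ρ i => (ρ i).1)

/-- The projection to the visited states is measurable, so that `prob` is not a junk value. -/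
instance (σ : 𝓜.Strategy) : IsProbabilityMeasure σ.prob := by
  refine Measure.isProbabilityMeasure_map (Measurable.aemeasurable ?_)
  let _ : MeasurableSpace S := ⊤
  let _ : MeasurableSpace (S × σ.Mem × A) := ⊤
  exact measurable_pi_lambda _ fun i => measurable_from_top.comp (measurable_pi_apply i)

end Strategy

end MDP

/-! ### Weighted reachability -/

open Classical in
/-- Weighted reachability: the value of the first visited target state, or `0` if there is none.
Only the values of `r` on `T` matter. -/
noncomputable def reachPayoff {S : Type*} (T : Set S) (r : S → ℝ) (ρ : Run S) : ℝ :=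
  if h : ∃ i, ρ i ∈ T then r (ρ (Nat.find h)) else 0

/-- The target set is reached almost surely under every strategy, or all target rewards are
non-negative. -/
def MDP.Attraction {S A : Type*} (𝓜 : MDP S A) (T : Set S) (r : S → ℝ) : Prop :=
  (∀ σ : 𝓜.Strategy, ∀ᵐ ρ ∂σ.prob, ∃ i, ρ i ∈ T) ∨ (∀ s ∈ T, 0 ≤ r s)

/-! ### Value-at-risk and conditional value-at-risk -/

/-- The value-at-risk of `X` at level `p`. For `0 < p < 1` and a real-valued random variable `X` on
a probability space, the set is non-empty and bounded above. -/
noncomputable def VaR {Ω : Type*} [MeasurableSpace Ω] (P : Measure Ω) (p : ℝ) (X : Ω → ℝ) : ℝ :=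
  sSup {x : ℝ | P.real {ω | X ω ≤ x} ≤ p}

/-- The conditional value-at-risk of `X` at level `p`, for `0 < p < 1`. -/
noncomputable def CVaR {Ω : Type*} [MeasurableSpace Ω] (P : Measure Ω) (p : ℝ) (X : Ω → ℝ) : ℝ :=
  (1 / p) * ((∫ ω in {ω | X ω < VaR P p X}, X ω ∂P) +
    (p - P.real {ω | X ω < VaR P p X}) * VaR P p X)

/-! ### Queries -/

/-- A single-dimensional weighted reachability query with constraints on the expectation, the
conditional value-at-risk and the value-at-risk. A threshold `⊥` means that there is no constraint
of this type. -/
structure ReachQuery (S : Type*) where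
  /-- the target states -/
  T : Set S
  /-- the reward function -/
  r : S → ℝ
  /-- the threshold for the expectation -/
  e : WithBot ℝ
  /-- the threshold for the conditional value-at-risk -/
  c : WithBot ℝ
  /-- the threshold for the value-at-risk -/
  v : WithBot ℝ
  /-- the level of the conditional value-at-risk -/
  p : ℝ
  /-- the level of the value-at-risk -/
  q : ℝ
  p_mem : p ∈ Set.Ioo (0 : ℝ) 1
  q_mem : q ∈ Set.Ioo (0 : ℝ) 1

/-- A strategy is a witness to a query if it meets all constraints. -/
def MDP.Strategy.IsWitness {S A : Type*} {𝓜 : MDP S A} (σ : 𝓜.Strategy) (Q : ReachQuery S) :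
    Prop :=
  Q.e ≤ ((∫ ρ, reachPayoff Q.T Q.r ρ ∂σ.prob : ℝ) : WithBot ℝ) ∧
  Q.c ≤ ((CVaR σ.prob Q.p (reachPayoff Q.T Q.r) : ℝ) : WithBot ℝ) ∧
  Q.v ≤ ((VaR σ.prob Q.q (reachPayoff Q.T Q.r) : ℝ) : WithBot ℝ)

/-! It suffices to find a memoryless strategy that hits each target state first with at least the
probability under the given `σ` (`exists_memoryless_le`). The payoff then becomes larger in
first-order stochastic dominance: mass moves only from the payoff 0 of never reaching `T` to
nonnegative rewards, or not at all if `T` is reached almost surely. Expectation, VaR and CVaR are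
monotone for this order.

The natural candidate plays each action in proportion to its expected number of uses under `σ`
before `T`. These numbers can be infinite, since a run may avoid `T` forever. The counts truncated
at time `n` are finite and solve linear inequalities whose right-hand sides converge; as finitely
generated cones are closed, the limiting system has a finite nonnegative solution (`exists_flow`).

This solution is only a leaky flow and may contain circulations. Normalising it at each state gives
a memoryless strategy, and `flow_le_of_sum_le` shows that its chain delivers at least as much to
every target: when the flow inequality is unrolled, the remainder is weighted by the probability of
first hitting the target after exactly `n + 1` steps, which tends to 0. -/

/-! ### Finitely generated convex cones -/

/-- The ratio test of the simplex method: `c` is the least `y i / z i` over the positive `z i`, the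
moment at which a first coordinate vanishes. -/
theorem exists_nonneg_sub_smul {ι : Type*} [Finite ι] {y z : ι → ℝ} (hy : 0 ≤ y)
    (hz : ∃ i, 0 < z i) :
    ∃ c : ℝ, 0 ≤ y - c • z ∧ ∃ i, z i ≠ 0 ∧ y i - c * z i = 0 := by
  classical
  have := Fintype.ofFinite ι
  obtain ⟨i₀, hi₀⟩ := hz
  obtain ⟨j, hj, hmin⟩ := Finset.exists_min_image (Finset.univ.filter fun i => 0 < z i)
    (fun i => y i / z i) ⟨i₀, by simpa using hi₀⟩
  simp only [Finset.mem_filter, Finset.mem_univ, true_and] at hj hmin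
  refine ⟨y j / z j, fun i => ?_, j, hj.ne', by field_simp; ring⟩
  have hc : 0 ≤ y j / z j := div_nonneg (hy j) hj.le
  simp only [Pi.zero_apply, Pi.sub_apply, Pi.smul_apply, smul_eq_mul, sub_nonneg]
  rcases lt_or_ge 0 (z i) with h | h
  · exact (le_div_iff₀ h).1 (hmin i h)
  · exact (mul_nonpos_of_nonneg_of_nonpos hc h).trans (hy i)

/-- A nonnegative combination can be rewritten with a support on which the map is injective. -/
theorem LinearMap.exists_nonneg_injOn_support {ι V : Type*} [Finite ι] [AddCommGroup V] [Module ℝ V]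
    (L : (ι → ℝ) →ₗ[ℝ] V) (y : ι → ℝ) (hy : 0 ≤ y) :
    ∃ y', 0 ≤ y' ∧ L y' = L y ∧ ∀ z, (∀ i, z i ≠ 0 → y' i ≠ 0) → L z = 0 → z = 0 := by
  induction hn : (Function.support y).ncard using Nat.strong_induction_on generalizing y with
  | _ n ih =>
  subst hn
  by_cases h : ∀ z, (∀ i, z i ≠ 0 → y i ≠ 0) → L z = 0 → z = 0
  · exact ⟨y, hy, rfl, h⟩
  push Not at h
  obtain ⟨z, hz, hLz, hne⟩ := h
  obtain ⟨w, hw, hLw, hpos⟩ : ∃ w : ι → ℝ, (∀ i, w i ≠ 0 → y i ≠ 0) ∧ L w = 0 ∧ ∃ i, 0 < w i := by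
    obtain ⟨i, hi⟩ := Function.ne_iff.1 hne
    rcases lt_or_gt_of_ne hi with hi | hi
    · exact ⟨-z, fun i hi => hz i (by simpa using hi), by simp [hLz], i, by simpa using hi⟩
    · exact ⟨z, hz, hLz, i, hi⟩
  obtain ⟨c, hc, j, hj, hj0⟩ := exists_nonneg_sub_smul hy hpos
  -- Index `j` leaves the support, and none enters because `w` vanishes off the support of `y`.
  have hlt : (Function.support (y - c • w)).ncard < (Function.support y).ncard := by
    refine Set.ncard_lt_ncard ⟨fun i hi hi0 => hi ?_, fun hsub => hsub (hw j hj) hj0⟩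
      (Set.toFinite _)
    have : w i = 0 := not_not.1 fun h => hw i h hi0
    simp [hi0, this]
  obtain ⟨y', h1, h2, h3⟩ := ih _ hlt _ hc rfl
  exact ⟨y', h1, by simp [h2, hLw], h3⟩

/-- Finitely generated convex cones are closed. -/
theorem LinearMap.isClosed_image_nonneg {ι V : Type*} [Finite ι] [AddCommGroup V] [Module ℝ V]
    [TopologicalSpace V] [IsTopologicalAddGroup V] [ContinuousSMul ℝ V] [T2Space V]
    (L : (ι → ℝ) →ₗ[ℝ] V) : IsClosed (L '' {y | 0 ≤ y}) := by
  let K : Set ι → Submodule ℝ (ι → ℝ) := fun J =>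
    { carrier := {z | ∀ i, z i ≠ 0 → i ∈ J}
      add_mem' := fun {a b} ha hb i hi => by
        by_contra h
        have h1 : a i = 0 := not_not.1 fun h' => h (ha i h')
        have h2 : b i = 0 := not_not.1 fun h' => h (hb i h')
        exact hi (by simp [h1, h2])
      zero_mem' := fun i hi => absurd rfl hi
      smul_mem' := fun c a ha i hi => ha i fun h => hi (by simp [h]) }
  -- Carathéodory: the finitely many coordinate faces on which `L` is injective already cover the
  -- cone, and an injective linear map from a finite-dimensional space is a closed embedding.
  have key : L '' {y | 0 ≤ y} = ⋃ J ∈ {J | Function.Injective (L.domRestrict (K J))},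
      L.domRestrict (K J) '' {y | 0 ≤ (y : ι → ℝ)} := by
    ext v
    simp only [Set.mem_image, Set.mem_ofPred_eq, Set.mem_iUnion]
    constructor
    · rintro ⟨y, hy, rfl⟩
      obtain ⟨y', h1, h2, h3⟩ := L.exists_nonneg_injOn_support y hy
      refine ⟨Function.support y', ?_, ⟨y', fun i hi => hi⟩, h1, h2⟩
      rw [← LinearMap.ker_eq_bot, LinearMap.ker_eq_bot']
      exact fun z hz => Subtype.ext (h3 z z.2 hz)
    · rintro ⟨J, -, y, hy, rfl⟩
      exact ⟨y, hy, rfl⟩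
  rw [key]
  refine (Set.toFinite _).isClosed_biUnion fun J hJ => ?_
  exact (LinearMap.isClosedEmbedding_of_injective (LinearMap.ker_eq_bot.2 hJ)).isClosedMap _
    (isClosed_le continuous_const continuous_subtype_val)

/-! ### Value-at-risk and conditional value-at-risk under stochastic dominance -/

section Risk

variable {Ω : Type*} [MeasurableSpace Ω] {P : Measure Ω} {X : Ω → ℝ} {M p : ℝ}

theorem nonempty_setOf_real_le (hM : ∀ ω, |X ω| ≤ M) (hp : 0 < p) :
    {x : ℝ | P.real {ω | X ω ≤ x} ≤ p}.Nonempty := by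
  refine ⟨-M - 1, ?_⟩
  have : {ω | X ω ≤ -M - 1} = ∅ :=
    Set.eq_empty_of_forall_notMem fun ω (h : X ω ≤ -M - 1) => by
      linarith [neg_le_of_abs_le (hM ω)]
  simp only [Set.mem_ofPred_eq, this, measureReal_empty, hp.le]

theorem bddAbove_setOf_real_le [IsProbabilityMeasure P] (hM : ∀ ω, |X ω| ≤ M) (hp : p < 1) :
    BddAbove {x : ℝ | P.real {ω | X ω ≤ x} ≤ p} := by
  refine ⟨M, fun x hx => ?_⟩
  by_contra! h
  have : {ω | X ω ≤ x} = Set.univ :=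
    Set.eq_univ_of_forall fun ω => ((le_abs_self _).trans (hM ω)).trans h.le
  simp only [Set.mem_ofPred_eq, this, probReal_univ] at hx
  linarith

variable {Ω' : Type*} [MeasurableSpace Ω'] {P' : Measure Ω'} {Y : Ω' → ℝ}

/-- The value-at-risk is monotone for first-order stochastic dominance. -/
theorem VaR_mono [IsProbabilityMeasure P'] (hX : Measurable X) (hY : Measurable Y)
    (hM : ∀ ω, |X ω| ≤ M)
    (hM' : ∀ ω, |Y ω| ≤ M) (hp : 0 < p) (hp1 : p < 1)
    (hdom : ∀ f : ℝ → ℝ, Monotone f → ∫ ω, f (X ω) ∂P ≤ ∫ ω, f (Y ω) ∂P') :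
    VaR P p X ≤ VaR P' p Y := by
  refine csSup_le_csSup (bddAbove_setOf_real_le hM' hp1) (nonempty_setOf_real_le hM hp)
    fun x (hx : P.real {ω | X ω ≤ x} ≤ p) => le_trans ?_ hx
  -- Minus the indicator of a lower ray is monotone, so dominance compares the distribution
  -- functions.
  have h := hdom (fun z => -(Set.Iic x).indicator (fun _ => 1) z) fun a b hab => by
    simp only [Set.indicator, Set.mem_Iic]
    split_ifs <;> linarith
  rw [integral_neg, integral_neg, neg_le_neg_iff] at h
  have e1 : ∀ ω, (Set.Iic x).indicator (fun _ => (1 : ℝ)) (X ω) =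
    {ω | X ω ≤ x}.indicator (fun _ => (1 : ℝ)) ω := fun _ => rfl
  have e2 : ∀ ω, (Set.Iic x).indicator (fun _ => (1 : ℝ)) (Y ω) =
    {ω | Y ω ≤ x}.indicator (fun _ => (1 : ℝ)) ω := fun _ => rfl
  simp only [e1, e2] at h
  rwa [integral_indicator_const _ (measurableSet_le hX measurable_const),
    integral_indicator_const _ (measurableSet_le hY measurable_const), smul_eq_mul, smul_eq_mul,
    mul_one, mul_one] at h

variable [IsProbabilityMeasure P]

theorem lt_real_of_VaR_lt (hM : ∀ ω, |X ω| ≤ M) (hp : p < 1) {x : ℝ} (hx : VaR P p X < x) :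
    p < P.real {ω | X ω ≤ x} := by
  by_contra! h
  exact absurd (le_csSup (bddAbove_setOf_real_le hM hp) h) (not_le.2 hx)

theorem real_le_of_lt_VaR (hM : ∀ ω, |X ω| ≤ M) (hp : 0 < p) {x : ℝ} (hx : x < VaR P p X) :
    P.real {ω | X ω ≤ x} ≤ p := by
  obtain ⟨y, hy, hxy⟩ := exists_lt_of_lt_csSup (nonempty_setOf_real_le hM hp) hx
  exact (measureReal_mono fun ω (h : X ω ≤ x) => h.trans hxy.le).trans hy

/-- The Rockafellar–Uryasev function, whose maximum is `p * CVaR P p X`. -/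
noncomputable def shortfall (P : Measure Ω) (p : ℝ) (X : Ω → ℝ) (x : ℝ) : ℝ :=
  p * x - ∫ ω, max (x - X ω) 0 ∂P

theorem integrable_max_sub (hX : Measurable X) (hM : ∀ ω, |X ω| ≤ M) (x : ℝ) :
    Integrable (fun ω => max (x - X ω) 0) P := by
  refine Integrable.of_bound (C := |x| + M)
    ((measurable_const.sub hX).max measurable_const).aestronglyMeasurable (ae_of_all _ fun ω => ?_)
  rw [Real.norm_eq_abs, abs_of_nonneg (le_max_right _ _)]
  refine max_le ?_ (add_nonneg (abs_nonneg _) ((abs_nonneg _).trans (hM ω)))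
  linarith [le_abs_self x, neg_le_of_abs_le (hM ω)]

/-- On `X ≤ a` the hinge `max (x - X) 0` grows with slope 1 between `a` and `b`, and elsewhere it
does not decrease. With `le_shortfall_sub`, this bounds chord slopes by `p - P[X ≤ ·]` at the two
ends. -/
theorem shortfall_sub_le (hX : Measurable X) (hM : ∀ ω, |X ω| ≤ M) {a b : ℝ} (hab : a ≤ b) :
    shortfall P p X b - shortfall P p X a ≤ (b - a) * (p - P.real {ω | X ω ≤ a}) := by
  have hmeas : MeasurableSet {ω | X ω ≤ a} := measurableSet_le hX measurable_const
  have h : ∫ ω, {ω | X ω ≤ a}.indicator (fun _ => b - a) ω ∂P ≤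
      ∫ ω, (max (b - X ω) 0 - max (a - X ω) 0) ∂P := by
    refine integral_mono ((integrable_const _).indicator hmeas)
      ((integrable_max_sub hX hM b).sub (integrable_max_sub hX hM a)) fun ω => ?_
    by_cases h : X ω ≤ a
    · simp only [Set.indicator, Set.mem_ofPred_eq, h, if_true]
      rw [max_eq_left (by linarith), max_eq_left (by linarith)]
      linarith
    · simp only [Set.indicator, Set.mem_ofPred_eq, h, if_false]
      exact sub_nonneg.2 (max_le_max (by linarith) le_rfl)
  rw [integral_sub (integrable_max_sub hX hM b) (integrable_max_sub hX hM a),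
    integral_indicator_const _ hmeas, smul_eq_mul] at h
  unfold shortfall
  linarith

theorem le_shortfall_sub (hX : Measurable X) (hM : ∀ ω, |X ω| ≤ M) {a b : ℝ} (hab : a ≤ b) :
    (b - a) * (p - P.real {ω | X ω ≤ b}) ≤ shortfall P p X b - shortfall P p X a := by
  have hmeas : MeasurableSet {ω | X ω ≤ b} := measurableSet_le hX measurable_const
  have h : ∫ ω, (max (b - X ω) 0 - max (a - X ω) 0) ∂P ≤
      ∫ ω, {ω | X ω ≤ b}.indicator (fun _ => b - a) ω ∂P := by
    refine integral_mono ((integrable_max_sub hX hM b).sub (integrable_max_sub hX hM a))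
      ((integrable_const _).indicator hmeas) fun ω => ?_
    by_cases h : X ω ≤ b
    · simp only [Set.indicator, Set.mem_ofPred_eq, h, if_true]
      rw [max_eq_left (by linarith)]
      linarith [le_max_left (a - X ω) 0]
    · simp only [Set.indicator, Set.mem_ofPred_eq, h, if_false]
      rw [max_eq_right (by linarith), max_eq_right (by linarith), sub_zero]
  rw [integral_sub (integrable_max_sub hX hM b) (integrable_max_sub hX hM a),
    integral_indicator_const _ hmeas, smul_eq_mul] at h
  unfold shortfall
  linarith

/-- The slope `p - P[X ≤ x]` is nonnegative to the left of the value-at-risk and negative to the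
right. -/
theorem shortfall_le_shortfall_VaR (hX : Measurable X) (hM : ∀ ω, |X ω| ≤ M) (hp : 0 < p)
    (hp1 : p < 1) (x : ℝ) : shortfall P p X x ≤ shortfall P p X (VaR P p X) := by
  set v := VaR P p X with hv
  rcases lt_trichotomy x v with hx | rfl | hx
  · refine le_of_forall_gt_imp_ge_of_dense fun y hy => ?_
    -- The sign of the slope is not controlled at `v` itself, so `w` stops short of it. Slopes are
    -- at least -1, so the last piece loses less than the allowed error.
    obtain ⟨w, hw1, hw2⟩ : ∃ w, max x (v - (y - shortfall P p X v)) < w ∧ w < v :=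
      exists_between (max_lt hx (by linarith))
    obtain ⟨hw3, hw4⟩ := max_lt_iff.1 hw1
    have h1 := le_shortfall_sub (P := P) (p := p) hX hM hw3.le
    have h2 := le_shortfall_sub (P := P) (p := p) hX hM hw2.le
    have h3 : 0 ≤ (w - x) * (p - P.real {ω | X ω ≤ w}) :=
      mul_nonneg (by linarith) (sub_nonneg.2 (real_le_of_lt_VaR hM hp hw2))
    have h4 : (v - w) * (-1) ≤ (v - w) * (p - P.real {ω | X ω ≤ v}) :=
      mul_le_mul_of_nonneg_left (by linarith [measureReal_le_one (μ := P) (s := {ω | X ω ≤ v})])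
        (by linarith)
    linarith
  · exact le_rfl
  · refine le_of_forall_gt_imp_ge_of_dense fun y hy => ?_
    obtain ⟨w, hw1, hw2⟩ : ∃ w, v < w ∧ w < min x (v + (y - shortfall P p X v)) :=
      exists_between (lt_min hx (by linarith))
    obtain ⟨hw3, hw4⟩ := lt_min_iff.1 hw2
    have h1 := shortfall_sub_le (P := P) (p := p) hX hM hw3.le
    have h2 := shortfall_sub_le (P := P) (p := p) hX hM hw1.le
    have h3 : 0 ≤ (x - w) * (P.real {ω | X ω ≤ w} - p) :=
      mul_nonneg (by linarith) (sub_nonneg.2 (lt_real_of_VaR_lt hM hp1 hw1).le)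
    have h4 : (w - v) * (p - P.real {ω | X ω ≤ v}) ≤ (w - v) * 1 :=
      mul_le_mul_of_nonneg_left (by linarith [measureReal_nonneg (μ := P) (s := {ω | X ω ≤ v})])
        (by linarith)
    linarith

theorem CVaR_eq_shortfall (hX : Measurable X) (hM : ∀ ω, |X ω| ≤ M) :
    CVaR P p X = 1 / p * shortfall P p X (VaR P p X) := by
  unfold CVaR shortfall
  set v := VaR P p X
  have hmeas : MeasurableSet {ω | X ω < v} := measurableSet_lt hX measurable_const
  have hint : Integrable X P := Integrable.of_bound hX.aestronglyMeasurable M (ae_of_all _ hM)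
  have h : ∫ ω, max (v - X ω) 0 ∂P = ∫ ω in {ω | X ω < v}, (v - X ω) ∂P := by
    rw [← integral_indicator hmeas]
    congr 1
    ext ω
    by_cases h : X ω < v
    · simp [Set.indicator, h, h.le]
    · simp [Set.indicator, h, not_lt.1 h]
  rw [h, integral_sub (integrable_const _) hint.integrableOn, setIntegral_const, smul_eq_mul]
  ring

/-- The conditional value-at-risk is monotone for first-order stochastic dominance. -/
theorem CVaR_mono [IsProbabilityMeasure P'] (hX : Measurable X) (hY : Measurable Y)
    (hM : ∀ ω, |X ω| ≤ M)
    (hM' : ∀ ω, |Y ω| ≤ M) (hp : 0 < p) (hp1 : p < 1)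
    (hdom : ∀ f : ℝ → ℝ, Monotone f → ∫ ω, f (X ω) ∂P ≤ ∫ ω, f (Y ω) ∂P') :
    CVaR P p X ≤ CVaR P' p Y := by
  rw [CVaR_eq_shortfall hX hM, CVaR_eq_shortfall hY hM']
  -- The level `VaR P p X` is optimal for `X` and merely a competitor for `Y`, so both shortfalls
  -- are compared at this one level.
  refine mul_le_mul_of_nonneg_left (le_trans ?_
    (shortfall_le_shortfall_VaR hY hM' hp hp1 (VaR P p X))) (by positivity)
  have h := hdom (fun z => -max (VaR P p X - z) 0) fun a b hab =>
    neg_le_neg (max_le_max (by linarith) le_rfl)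
  rw [integral_neg, integral_neg] at h
  unfold shortfall
  linarith

end Risk

/-! ### Limits of systems of linear inequalities -/

open Filter Topology in
-- Slack variables turn the inequalities into membership in a finitely generated cone, which is
-- closed. The `y n` may be unbounded and need not converge to `y'`.
theorem LinearMap.exists_nonneg_map_le_of_tendsto {ι κ : Type*} [Finite ι] [Finite κ]
    (L : (ι → ℝ) →ₗ[ℝ] (κ → ℝ)) {y : ℕ → ι → ℝ} {b : ℕ → κ → ℝ} {b' : κ → ℝ}
    (hy : ∀ n, 0 ≤ y n) (hL : ∀ n, L (y n) ≤ b n) (hb : Tendsto b atTop (𝓝 b')) :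
    ∃ y', 0 ≤ y' ∧ L y' ≤ b' := by
  let L' : (ι ⊕ κ → ℝ) →ₗ[ℝ] (κ → ℝ) :=
    L ∘ₗ LinearMap.funLeft ℝ ℝ Sum.inl + LinearMap.funLeft ℝ ℝ Sum.inr
  have hmem : ∀ n, b n ∈ L' '' {z | 0 ≤ z} := fun n => by
    refine ⟨Sum.elim (y n) (b n - L (y n)), ?_, ?_⟩
    · rintro (i | k)
      · exact hy n i
      · exact sub_nonneg.2 (hL n k)
    · change L (y n) + (b n - L (y n)) = b n
      abel
  obtain ⟨z, hz, rfl⟩ := L'.isClosed_image_nonneg.mem_of_tendsto hb (Eventually.of_forall hmem)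
  refine ⟨z ∘ Sum.inl, fun i => hz _, fun k => ?_⟩
  exact le_add_of_nonneg_right (hz (Sum.inr k))

/-! ### Leaky flows and absorption -/

section Passage

variable {S : Type*} (N : Finset S) (P : S → S → ℝ) (t : S)

/-- The weight of the paths to `t` with `n + 1` steps, all of them from states in `N`. -/
def passage : ℕ → S → ℝ
  | 0 => fun s => P s t
  | n + 1 => fun s => ∑ s' ∈ N, P s s' * passage n s'

variable {N P t}

theorem passage_nonneg (hP : ∀ s s', 0 ≤ P s s') (n : ℕ) (s : S) : 0 ≤ passage N P t n s := by
  induction n generalizing s with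
  | zero => exact hP _ _
  | succ n ih => exact Finset.sum_nonneg fun s' _ => mul_nonneg (hP _ _) (ih s')

/-- Since `t ∉ N`, the passages of different lengths are disjoint first-hitting events; the
induction conditions on the first step. -/
theorem sum_passage_le_one [Fintype S] (hP : ∀ s s', 0 ≤ P s s') (hrow : ∀ s ∈ N, ∑ s', P s s' ≤ 1)
    (ht : t ∉ N) (n : ℕ) {s : S} (hs : s ∈ N) :
    ∑ k ∈ Finset.range n, passage N P t k s ≤ 1 := by
  classical
  induction n generalizing s with
  | zero => simp
  | succ n ih =>
    rw [Finset.sum_range_succ']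
    simp only [passage]
    rw [Finset.sum_comm]
    calc _ ≤ ∑ s' ∈ N, P s s' + P s t := by
            refine add_le_add (Finset.sum_le_sum fun s' hs' => ?_) le_rfl
            rw [← Finset.mul_sum]
            exact mul_le_of_le_one_right (hP _ _) (ih hs')
      _ = ∑ s' ∈ insert t N, P s s' := by rw [Finset.sum_insert ht, add_comm]
      _ ≤ ∑ s', P s s' := Finset.sum_le_sum_of_subset_of_nonneg (Finset.subset_univ _)
            fun _ _ _ => hP _ _
      _ ≤ 1 := hrow s hs

open Filter Topology in
theorem tendsto_passage [Fintype S] (hP : ∀ s s', 0 ≤ P s s') (hrow : ∀ s ∈ N, ∑ s', P s s' ≤ 1)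
    (ht : t ∉ N) {s : S} (hs : s ∈ N) : Tendsto (fun n => passage N P t n s) atTop (𝓝 0) :=
  (summable_of_sum_range_le (fun n => passage_nonneg hP n s)
    fun n => sum_passage_le_one hP hrow ht n hs).tendsto_atTop_zero

theorem sum_mul_passage {ν : ℕ → S → ℝ} (hν : ∀ n s', ν (n + 1) s' = ∑ s ∈ N, ν n s * P s s')
    (k n : ℕ) : ∑ s ∈ N, ν n s * passage N P t k s = ν (n + k + 1) t := by
  induction k generalizing n with
  | zero => exact (hν n t).symm
  | succ k ih =>
    rw [show n + (k + 1) + 1 = (n + 1) + k + 1 by ring, ← ih]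
    simp only [passage, hν n, Finset.mul_sum, Finset.sum_mul]
    rw [Finset.sum_comm]
    simp only [mul_assoc]

open Filter Topology in
/-- What a leaky flow `Y` delivers to `t` is at most what the chain delivers, whose distribution
before absorption is `ν`. -/
theorem flow_le_of_sum_le [Fintype S] (hP : ∀ s s', 0 ≤ P s s')
    (hrow : ∀ s ∈ N, ∑ s', P s s' ≤ 1) (ht : t ∉ N) {ν : ℕ → S → ℝ}
    (hν : ∀ n s', ν (n + 1) s' = ∑ s ∈ N, ν n s * P s s') {Y : S → ℝ}
    (hY : ∀ s' ∈ N, Y s' ≤ ν 0 s' + ∑ s ∈ N, Y s * P s s') {c : ℝ}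
    (hc : ∀ n, ∑ k ∈ Finset.range n, ν k t ≤ c) :
    ν 0 t + ∑ s ∈ N, Y s * P s t ≤ c := by
  -- Substituting the flow inequality once: the initial mass reaches `t` at time `n + 1`, and the
  -- mass fed in by `Y` needs one step more.
  have hstep : ∀ n, ∑ s ∈ N, Y s * passage N P t n s ≤
      ν (n + 1) t + ∑ s ∈ N, Y s * passage N P t (n + 1) s := fun n => by
    calc _ ≤ ∑ s' ∈ N, (ν 0 s' + ∑ s ∈ N, Y s * P s s') * passage N P t n s' :=
          Finset.sum_le_sum fun s' hs' =>
            mul_le_mul_of_nonneg_right (hY s' hs') (passage_nonneg hP _ _)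
      _ = _ := by
          simp only [add_mul, Finset.sum_add_distrib]
          rw [sum_mul_passage hν, zero_add]
          simp only [passage, Finset.mul_sum, Finset.sum_mul]
          rw [Finset.sum_comm]
          simp only [mul_assoc]
  have hsum : ∀ n, ν 0 t + ∑ s ∈ N, Y s * P s t ≤
      ∑ k ∈ Finset.range (n + 1), ν k t + ∑ s ∈ N, Y s * passage N P t n s := fun n => by
    induction n with
    | zero => simp [passage]
    | succ n ih =>
      rw [Finset.sum_range_succ]
      linarith [hstep n]
  -- `Y` is fixed and the passage weights vanish, so circulations in `Y` contribute nothing in the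
  -- limit.
  have hlim : Tendsto (fun n => c + ∑ s ∈ N, Y s * passage N P t n s) atTop
      (𝓝 (c + ∑ s ∈ N, Y s * 0)) :=
    tendsto_const_nhds.add (tendsto_finsetSum _ fun s hs =>
      (tendsto_passage hP hrow ht hs).const_mul _)
  simp only [mul_zero, Finset.sum_const_zero, add_zero] at hlim
  exact ge_of_tendsto' hlim fun n => (hsum n).trans (add_le_add (hc _) le_rfl)

end Passage

/-- A nonnegative function on a finite nonempty set is proportional to a distribution. -/
theorem PMF.exists_eq_sum_mul {A : Type*} [Fintype A] (B : Finset A) (hB : B.Nonempty) (y : A → ℝ)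
    (hy : 0 ≤ y) : ∃ p : PMF A, p.support ⊆ B ∧ ∀ a ∈ B, y a = (∑ a' ∈ B, y a') * (p a).toReal := by
  classical
  rcases (Finset.sum_nonneg fun a _ => hy a : 0 ≤ ∑ a' ∈ B, y a').eq_or_lt with h | h
  · obtain ⟨a₀, ha₀⟩ := hB
    refine ⟨PMF.pure a₀, by simpa using ha₀, fun a ha => ?_⟩
    rw [← h, zero_mul]
    exact (Finset.sum_eq_zero_iff_of_nonneg fun a _ => hy a).1 h.symm a ha
  · refine ⟨PMF.ofFinset (fun a => if a ∈ B then ENNReal.ofReal (y a / ∑ a' ∈ B, y a') else 0) B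
      ?_ fun a ha => if_neg ha, fun a ha => ?_, fun a ha => ?_⟩
    · rw [Finset.sum_congr rfl fun a ha => if_pos ha,
        ← ENNReal.ofReal_sum_of_nonneg fun a _ => div_nonneg (hy a) h.le, ← Finset.sum_div,
        div_self h.ne', ENNReal.ofReal_one]
    · by_contra hB
      exact ha (if_neg hB)
    · rw [PMF.ofFinset_apply, if_pos ha, ENNReal.toReal_ofReal (div_nonneg (hy a) h.le),
        mul_div_cancel₀ _ h.ne']

/-! ### One-step identities for the run measure -/

theorem Run.measurable_eval {X Y : Type*} [MeasurableSpace Y] (n : ℕ) (g : X → Y) :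
    Measurable fun ρ : Run X => g (ρ n) :=
  let _ : MeasurableSpace X := ⊤
  measurable_from_top.comp (measurable_pi_apply n)

theorem Run.measurableSet_eval {X : Type*} (n : ℕ) (D : Set X) :
    MeasurableSet {ρ : Run X | ρ n ∈ D} :=
  let _ : MeasurableSpace X := ⊤
  Run.measurable_eval n id (MeasurableSpace.measurableSet_top : MeasurableSet D)

theorem Run.measurableSet_forall {X : Type*} (p : ℕ → Prop) (D : Set X) :
    MeasurableSet {ρ : Run X | ∀ i, p i → ρ i ∈ D} := by
  simp only [Set.ofPred_forall]
  exact MeasurableSet.iInter fun i => MeasurableSet.iInter fun _ => Run.measurableSet_eval i D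

namespace MarkovChain

variable {X : Type*} (C : MarkovChain X)

theorem law_zero (D : Set X) : C.law {ρ | ρ 0 ∈ D} = C.init.toOuterMeasure D := by
  let _ : MeasurableSpace X := ⊤
  have h0 : (Kernel.trajMeasure (X := fun _ : ℕ => X) C.init.toMeasure C.kernel).map
      (Preorder.frestrictLe 0) = C.init.toMeasure.map
        (MeasurableEquiv.piUnique (fun _ : Finset.Iic 0 => X)).symm := by
    rw [Kernel.trajMeasure, Measure.map_comp _ _ (Preorder.measurable_frestrictLe 0),
      Kernel.traj_map_frestrictLe, Kernel.partialTraj_self]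
    exact Measure.id_comp
  have hm : MeasurableSet {h : (_ : Finset.Iic 0) → X | h ⟨0, by simp⟩ ∈ D} :=
    measurable_pi_apply (⟨0, by simp⟩ : Finset.Iic 0)
      (MeasurableSpace.measurableSet_top : MeasurableSet D)
  have h1 := congrArg (fun μ => μ {h : (_ : Finset.Iic 0) → X | h ⟨0, by simp⟩ ∈ D}) h0
  beta_reduce at h1
  rw [Measure.map_apply (Preorder.measurable_frestrictLe 0) hm,
    Measure.map_apply (MeasurableEquiv.measurable _) hm,
    PMF.toMeasure_apply_eq_toOuterMeasure] at h1
  exact h1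

theorem law_step (n : ℕ) (G D : Set X) :
    C.law {ρ | (∀ i, i ≤ n → ρ i ∈ G) ∧ ρ (n + 1) ∈ D} =
      ∫⁻ ρ in {ρ | ∀ i, i ≤ n → ρ i ∈ G}, (C.step (ρ n)).toOuterMeasure D ∂C.law := by
  let _ : MeasurableSpace X := ⊤
  let μ : Measure (ℕ → X) := Kernel.trajMeasure (X := fun _ : ℕ => X) C.init.toMeasure C.kernel
  have hμ : IsProbabilityMeasure μ := inferInstanceAs (IsProbabilityMeasure
    (Kernel.trajMeasure (X := fun _ : ℕ => X) C.init.toMeasure C.kernel))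
  have hres : Measurable (Preorder.frestrictLe (π := fun _ : ℕ => X) n) :=
    Preorder.measurable_frestrictLe n
  have hD : MeasurableSet D := MeasurableSpace.measurableSet_top
  let B : Set (Finset.Iic n → X) := {h | ∀ i, h i ∈ G}
  have hB : MeasurableSet B := by
    simp only [B, Set.ofPred_forall]
    exact MeasurableSet.iInter fun i => measurable_pi_apply i
      (MeasurableSpace.measurableSet_top : MeasurableSet G)
  have hBpre : Preorder.frestrictLe n ⁻¹' B = {ρ : ℕ → X | ∀ i, i ≤ n → ρ i ∈ G} := by
    ext ρ
    exact ⟨fun h i hi => h ⟨i, Finset.mem_Iic.2 hi⟩, fun h i => h i (Finset.mem_Iic.1 i.2)⟩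
  have hstep : μ.map (Preorder.frestrictLe n) ⊗ₘ C.kernel n =
      μ.map (fun x => (Preorder.frestrictLe n x, x (n + 1))) :=
    Kernel.map_frestrictLe_trajMeasure_compProd_eq_map_trajMeasure
  have hm : Measurable (fun x : ℕ → X => (Preorder.frestrictLe (π := fun _ : ℕ => X) n x,
      x (n + 1))) := hres.prodMk (measurable_pi_apply _)
  have h1 := congrArg (fun ν => ν (B ×ˢ D)) hstep
  beta_reduce at h1
  rw [Measure.compProd_apply_prod hB hD, Measure.map_apply hm (hB.prod hD),
    setLIntegral_map hB ((C.kernel n).measurable_coe hD) hres, hBpre] at h1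
  have h2 : (fun x : ℕ → X => (Preorder.frestrictLe (π := fun _ : ℕ => X) n x, x (n + 1))) ⁻¹'
      (B ×ˢ D) = {ρ | (∀ i, i ≤ n → ρ i ∈ G) ∧ ρ (n + 1) ∈ D} := by
    rw [Set.mk_preimage_prod, hBpre]
    rfl
  rw [h2] at h1
  refine h1.symm.trans (lintegral_congr fun ρ => ?_)
  exact PMF.toMeasure_apply_eq_toOuterMeasure _ D

/-- A ratio common to the initial and all one-step distributions survives conditioning on the past.
It serves with `c = 0` for null events and with `c` a move probability for memoryless strategies. -/
theorem law_forall_lt_and (n : ℕ) (G D E : Set X) (c : ENNReal)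
    (hinit : C.init.toOuterMeasure D = c * C.init.toOuterMeasure E)
    (hstep : ∀ x, (C.step x).toOuterMeasure D = c * (C.step x).toOuterMeasure E) :
    C.law {ρ | (∀ i, i < n → ρ i ∈ G) ∧ ρ n ∈ D} =
      c * C.law {ρ | (∀ i, i < n → ρ i ∈ G) ∧ ρ n ∈ E} := by
  cases n with
  | zero => simpa [law_zero] using hinit
  | succ n =>
    simp only [Nat.lt_succ_iff]
    rw [law_step, law_step, ← lintegral_const_mul]
    · simp only [hstep]
    · exact Run.measurable_eval n fun x => (C.step x).toOuterMeasure E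

end MarkovChain

/-! ### Visits and actions before the target -/

namespace MDP

variable {S A : Type*} {𝓜 : MDP S A}

/-- The state in which an action is enabled. -/
noncomputable def owner (𝓜 : MDP S A) (a : A) : S := (𝓜.av_partition a).choose

theorem mem_Av_iff {s : S} {a : A} : a ∈ 𝓜.Av s ↔ 𝓜.owner a = s :=
  ⟨fun h => ((𝓜.av_partition a).choose_spec.2 s h).symm,
    fun h => h ▸ (𝓜.av_partition a).choose_spec.1⟩

namespace Strategy

variable (σ : 𝓜.Strategy) (T : Set S)

/-- The strategy enters a state drawn from `d`, updates its memory by `u` and chooses a move. -/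
noncomputable def enter (d : PMF S) (u : S → PMF σ.Mem) : PMF (S × σ.Mem × A) :=
  d.bind fun s => (u s).bind fun m => (σ.next s m).bind fun a => PMF.pure (s, m, a)

theorem play_init_eq : σ.play.init = σ.enter (PMF.pure 𝓜.s₀) fun _ => σ.start := by
  rw [enter, PMF.pure_bind]
  rfl

theorem play_step_eq (x : S × σ.Mem × A) :
    σ.play.step x = σ.enter (𝓜.Δ x.2.2) fun s => σ.update x.2.2 s x.2.1 := rfl

theorem enter_fst (d : PMF S) (u : S → PMF σ.Mem) (s : S) :
    (σ.enter d u).toOuterMeasure {x | x.1 = s} = d s := by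
  have : (σ.enter d u).map Prod.fst = d := by
    simp [enter, PMF.map_bind, PMF.pure_map]
  rw [← PMF.toOuterMeasure_apply_singleton, ← this, PMF.toOuterMeasure_map_apply]
  rw [this]
  rfl

theorem enter_owner_ne (d : PMF S) (u : S → PMF σ.Mem) :
    (σ.enter d u).toOuterMeasure {x | 𝓜.owner x.2.2 ≠ x.1} = 0 := by
  rw [PMF.toOuterMeasure_apply_eq_zero_iff, Set.disjoint_left]
  rintro ⟨s, m, a⟩ hx hne
  simp only [enter, PMF.mem_support_bind_iff, PMF.mem_support_pure_iff, Prod.mk.injEq] at hx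
  obtain ⟨s', -, m', -, a', ha', rfl, rfl, rfl⟩ := hx
  exact hne (mem_Av_iff.1 (σ.next_support _ _ ha'))

theorem ae_owner_eq (n : ℕ) : ∀ᵐ ρ ∂σ.play.law, 𝓜.owner (ρ n).2.2 = (ρ n).1 := by
  have h := σ.play.law_forall_lt_and n Set.univ {x | 𝓜.owner x.2.2 ≠ x.1} ∅ 0
    (by rw [play_init_eq, enter_owner_ne, zero_mul])
    fun x => by rw [play_step_eq, enter_owner_ne, zero_mul]
  rw [zero_mul] at h
  rw [ae_iff]
  refine measure_mono_null (fun ρ hρ => ?_) h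
  exact ⟨fun _ _ => trivial, hρ⟩

/-- The probability that the state after `n` steps is `s` and no earlier state is in `T`. -/
noncomputable def visit (n : ℕ) (s : S) : ℝ :=
  σ.play.law.real {ρ | (∀ i, i < n → ρ i ∈ {x | x.1 ∉ T}) ∧ ρ n ∈ {x | x.1 = s}}

/-- The probability that action `a` is taken after `n` steps, before `T` is reached. -/
noncomputable def take (n : ℕ) (a : A) : ℝ :=
  σ.play.law.real {ρ | (∀ i, i ≤ n → ρ i ∈ {x | x.1 ∉ T}) ∧ ρ n ∈ {x | x.2.2 = a}}

variable {T}

theorem take_eq_zero {a : A} (ha : 𝓜.owner a ∈ T) (n : ℕ) : σ.take T n a = 0 := by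
  rw [take, measureReal_eq_zero_iff]
  refine measure_mono_null (fun ρ hρ => ?_) (ae_iff.1 (σ.ae_owner_eq n))
  obtain ⟨h1, rfl⟩ := hρ
  intro h
  exact h1 n le_rfl (h ▸ ha)

theorem visit_zero [DecidableEq S] (s : S) : σ.visit T 0 s = if s = 𝓜.s₀ then 1 else 0 := by
  have : σ.play.law {ρ | (∀ i, i < 0 → ρ i ∈ {x | x.1 ∉ T}) ∧ ρ 0 ∈ {x | x.1 = s}} =
      σ.play.law {ρ | ρ 0 ∈ {x | x.1 = s}} := by simp
  rw [visit, measureReal_def, this, MarkovChain.law_zero, play_init_eq, enter_fst, PMF.pure_apply]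
  split_ifs <;> simp

/-- Almost surely the chosen action belongs to the current state; as `s ∉ T`, the bounds `i < n` and
`i ≤ n` then agree. -/
theorem visit_eq_sum_take [Fintype A] [DecidableEq S] {s : S} (hs : s ∉ T) (n : ℕ) :
    σ.visit T n s = ∑ a with 𝓜.owner a = s, σ.take T n a := by
  classical
  have hm := Run.measurableSet_forall (fun i => i ≤ n) {x : S × σ.Mem × A | x.1 ∉ T}
  have h := sum_measureReal_preimage_singleton
    (μ := σ.play.law.restrict {ρ | ∀ i, i ≤ n → ρ i ∈ {x | x.1 ∉ T}})
    (Finset.univ.filter fun a => 𝓜.owner a = s) (f := fun ρ => (ρ n).2.2)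
    fun a _ => Run.measurableSet_eval n {x : S × σ.Mem × A | x.2.2 = a}
  calc _ = σ.play.law.real ((fun ρ => (ρ n).2.2) ⁻¹'
        ↑(Finset.univ.filter fun a => 𝓜.owner a = s) ∩
          {ρ | ∀ i, i ≤ n → ρ i ∈ {x | x.1 ∉ T}}) := by
        rw [visit]
        refine measureReal_congr ?_
        filter_upwards [σ.ae_owner_eq n] with ρ hρ
        refine propext ?_
        change (∀ i, i < n → (ρ i).1 ∉ T) ∧ (ρ n).1 = s ↔
          ρ ∈ (fun ρ => (ρ n).2.2) ⁻¹' ↑(Finset.univ.filter fun a => 𝓜.owner a = s) ∧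
            ∀ i, i ≤ n → (ρ i).1 ∉ T
        simp only [Finset.coe_filter, Finset.mem_univ, true_and, Set.mem_preimage,
          Set.mem_ofPred_eq, hρ]
        constructor
        · rintro ⟨h1, h2⟩
          refine ⟨h2, fun i hi => ?_⟩
          rcases hi.lt_or_eq with hi | rfl
          · exact h1 i hi
          · rwa [h2]
        · rintro ⟨h1, h2⟩
          exact ⟨fun i hi => h2 i hi.le, h1⟩
    _ = _ := by
        rw [← measureReal_restrict_apply' hm, ← h]
        refine Finset.sum_congr rfl fun a _ => ?_
        rw [measureReal_restrict_apply' hm, take, Set.inter_comm]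
        rfl

theorem visit_succ [Fintype A] (n : ℕ) (s : S) :
    σ.visit T (n + 1) s = ∑ a, σ.take T n a * (𝓜.Δ a s).toReal := by
  classical
  have hm := Run.measurableSet_forall (fun i => i ≤ n) {x : S × σ.Mem × A | x.1 ∉ T}
  have hmeas : ∀ a, MeasurableSet {ρ : Run (S × σ.Mem × A) | (ρ n).2.2 = a} :=
    fun a => Run.measurableSet_eval n {x : S × σ.Mem × A | x.2.2 = a}
  simp only [visit, Nat.lt_succ_iff]
  rw [measureReal_def, MarkovChain.law_step]
  have h : ∀ ρ : Run (S × σ.Mem × A), (σ.play.step (ρ n)).toOuterMeasure {x | x.1 = s} =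
      ∑ a, {ρ : Run (S × σ.Mem × A) | (ρ n).2.2 = a}.indicator (fun _ => 𝓜.Δ a s) ρ := fun ρ => by
    rw [play_step_eq, enter_fst, Finset.sum_eq_single (ρ n).2.2]
    · exact (Set.indicator_of_mem (s := {ρ' : Run (S × σ.Mem × A) | (ρ' n).2.2 = (ρ n).2.2}) rfl
        fun _ => 𝓜.Δ (ρ n).2.2 s).symm
    · exact fun a _ ha => Set.indicator_of_notMem (fun h => ha h.symm) _
    · exact fun h => absurd (Finset.mem_univ _) h
  simp only [h]
  rw [lintegral_finsetSum _ fun a _ => measurable_const.indicator (hmeas a), ENNReal.toReal_sum]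
  · refine Finset.sum_congr rfl fun a _ => ?_
    rw [lintegral_indicator_const (hmeas a), ENNReal.toReal_mul, mul_comm, take, measureReal_def,
      Measure.restrict_apply (hmeas a), Set.inter_comm]
    rfl
  · intro a _
    rw [lintegral_indicator_const (hmeas a)]
    exact ENNReal.mul_ne_top (PMF.apply_ne_top _ _) (measure_ne_top _ _)

end Strategy

/-- The memoryless strategy with next moves `p`. -/
noncomputable def memoryless (p : S → PMF A) (hp : ∀ s, (p s).support ⊆ 𝓜.Av s) :
    𝓜.Strategy where
  Mem := Unit
  mem_countable := inferInstance
  update _ _ _ := PMF.pure ()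
  next s _ := p s
  start := PMF.pure ()
  next_support s _ := hp s

theorem isMemoryless_memoryless (p : S → PMF A) (hp : ∀ s, (p s).support ⊆ 𝓜.Av s) :
    (memoryless p hp).IsMemoryless := ⟨inferInstanceAs (Unique Unit)⟩

theorem enter_memoryless (p : S → PMF A) (hp : ∀ s, (p s).support ⊆ 𝓜.Av s) (d : PMF S)
    (u : S → PMF (memoryless p hp).Mem) (s : S) (a : A) :
    ((memoryless p hp).enter d u).toOuterMeasure {x | x.1 = s ∧ x.2.2 = a} = p s a * d s := by
  have hmap : ((memoryless p hp).enter d u).map (fun x => (x.1, x.2.2)) =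
      d.bind fun s' => (p s').bind fun a' => PMF.pure (s', a') := by
    have hnext : ∀ s m, (memoryless p hp).next s m = p s := fun _ _ => rfl
    simp [Strategy.enter, PMF.map_bind, PMF.pure_map, hnext]
  have hset : {x : S × (memoryless p hp).Mem × A | x.1 = s ∧ x.2.2 = a} =
      (fun x => (x.1, x.2.2)) ⁻¹' {(s, a)} := by
    ext x
    simp
  rw [hset, ← PMF.toOuterMeasure_map_apply, hmap, PMF.toOuterMeasure_apply_singleton,
    PMF.bind_apply, tsum_eq_single s, PMF.bind_apply, tsum_eq_single a]
  · simp [mul_comm]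
  · intro a' ha'
    simp [ha'.symm]
  · intro s' hs'
    simp [PMF.bind_apply, hs'.symm]

/-- The move is independent of the past given the current state; this is the only point that needs
the strategy to be memoryless. -/
theorem take_memoryless (p : S → PMF A) (hp : ∀ s, (p s).support ⊆ 𝓜.Av s) {T : Set S} {a : A}
    (ha : 𝓜.owner a ∉ T) (n : ℕ) : (memoryless p hp).take T n a =
      (memoryless p hp).visit T n (𝓜.owner a) * (p (𝓜.owner a) a).toReal := by
  set τ := memoryless p hp
  have h := τ.play.law_forall_lt_and n {x | x.1 ∉ T} {x | x.1 = 𝓜.owner a ∧ x.2.2 = a}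
    {x | x.1 = 𝓜.owner a} (p (𝓜.owner a) a)
    (by rw [τ.play_init_eq, enter_memoryless, τ.enter_fst])
    fun x => by rw [τ.play_step_eq, enter_memoryless, τ.enter_fst]
  rw [Strategy.visit, measureReal_def, mul_comm, ← ENNReal.toReal_mul, ← h, ← measureReal_def,
    Strategy.take]
  refine measureReal_congr ?_
  filter_upwards [τ.ae_owner_eq n] with ρ hρ
  refine propext ?_
  change (∀ i, i ≤ n → (ρ i).1 ∉ T) ∧ (ρ n).2.2 = a ↔
    (∀ i, i < n → (ρ i).1 ∉ T) ∧ (ρ n).1 = 𝓜.owner a ∧ (ρ n).2.2 = a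
  constructor
  · rintro ⟨h1, rfl⟩
    exact ⟨fun i hi => h1 i hi.le, hρ.symm, rfl⟩
  · rintro ⟨h1, h2, h3⟩
    refine ⟨fun i hi => ?_, h3⟩
    rcases hi.lt_or_eq with hi | rfl
    · exact h1 i hi
    · rwa [h2]

end MDP

/-! ### The law of the payoff -/

/-- The runs whose first visited target state is `t`. -/
def firstTarget {S : Type*} (T : Set S) (t : S) : Set (Run S) :=
  ⋃ n, {ρ | (∀ i, i < n → ρ i ∈ Tᶜ) ∧ ρ n ∈ ({t} : Set S)}

theorem measurableSet_firstTarget {S : Type*} (T : Set S) (t : S) :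
    MeasurableSet (firstTarget T t) :=
  MeasurableSet.iUnion fun n =>
    (Run.measurableSet_forall (fun i => i < n) Tᶜ).inter (Run.measurableSet_eval n {t})

open Classical in
-- The value `f 0` of never reaching `T` is the baseline, so later only the gains `f (r t) - f 0`
-- need a sign.
theorem comp_reachPayoff {S : Type*} [Fintype S] (T : Set S) (r : S → ℝ) (f : ℝ → ℝ) (ρ : Run S) :
    f (reachPayoff T r ρ) =
      f 0 + ∑ t with t ∈ T, (firstTarget T t).indicator (fun _ => f (r t) - f 0) ρ := by
  unfold reachPayoff
  split_ifs with h
  · have hmem : ρ ∈ firstTarget T (ρ (Nat.find h)) :=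
      Set.mem_iUnion.2 ⟨Nat.find h, fun i hi => Nat.find_min h hi, rfl⟩
    rw [Finset.sum_eq_single (ρ (Nat.find h)), Set.indicator_of_mem hmem]
    · ring
    · intro t ht hne
      refine Set.indicator_of_notMem (fun hρ => hne ?_) _
      obtain ⟨n, hn, rfl⟩ := Set.mem_iUnion.1 hρ
      rw [(Nat.find_eq_iff h).2 ⟨(Finset.mem_filter.1 ht).2, fun i hi => hn i hi⟩]
    · intro hn
      exact absurd (Finset.mem_filter.2 ⟨Finset.mem_univ _, Nat.find_spec h⟩) hn
  · rw [Finset.sum_eq_zero, add_zero]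
    intro t ht
    refine Set.indicator_of_notMem (fun hρ => h ?_) _
    obtain ⟨n, -, rfl⟩ := Set.mem_iUnion.1 hρ
    exact ⟨n, (Finset.mem_filter.1 ht).2⟩

theorem measurable_reachPayoff {S : Type*} [Fintype S] (T : Set S) (r : S → ℝ) :
    Measurable (reachPayoff T r) := by
  classical
  have : reachPayoff T r = fun ρ => 0 + ∑ t with t ∈ T,
      (firstTarget T t).indicator (fun _ => r t - 0) ρ :=
    funext fun ρ => comp_reachPayoff T r id ρ
  rw [this]
  exact measurable_const.add (Finset.measurable_sum _ fun t _ =>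
    measurable_const.indicator (measurableSet_firstTarget T t))

theorem abs_reachPayoff_le {S : Type*} [Fintype S] (T : Set S) (r : S → ℝ) (ρ : Run S) :
    |reachPayoff T r ρ| ≤ ∑ s, |r s| := by
  unfold reachPayoff
  split_ifs with h
  · exact Finset.single_le_sum (f := fun s => |r s|) (fun s _ => abs_nonneg _) (Finset.mem_univ _)
  · simpa using Finset.sum_nonneg fun s _ => abs_nonneg (r s)

open Classical in
theorem integral_comp_reachPayoff {S : Type*} [Fintype S] (P : Measure (Run S))
    [IsProbabilityMeasure P] (T : Set S) (r : S → ℝ) (f : ℝ → ℝ) :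
    ∫ ρ, f (reachPayoff T r ρ) ∂P =
      f 0 + ∑ t with t ∈ T, P.real (firstTarget T t) * (f (r t) - f 0) := by
  have hint : ∀ t, Integrable ((firstTarget T t).indicator fun _ => f (r t) - f 0) P :=
    fun t => (integrable_const _).indicator (measurableSet_firstTarget T t)
  simp only [comp_reachPayoff T r f]
  rw [integral_add (integrable_const _) (integrable_finsetSum _ fun t _ => hint t),
    integral_finsetSum _ fun t _ => hint t, integral_const, probReal_univ, one_smul]
  simp only [integral_indicator_const _ (measurableSet_firstTarget T _), smul_eq_mul]

open Classical in
theorem sum_firstTarget_eq_one {S : Type*} [Fintype S] {P : Measure (Run S)}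
    [IsProbabilityMeasure P] {T : Set S} (h : ∀ᵐ ρ ∂P, ∃ i, ρ i ∈ T) :
    ∑ t with t ∈ T, P.real (firstTarget T t) = 1 := by
  have h1 := integral_comp_reachPayoff P T (fun _ => 1) id
  have h2 : ∫ ρ, id (reachPayoff T (fun _ => 1) ρ) ∂P = ∫ _, (1 : ℝ) ∂P :=
    integral_congr_ae (by
      filter_upwards [h] with ρ hρ
      simp only [reachPayoff, hρ, dif_pos, id])
  rw [h2] at h1
  simpa using h1.symm

/-- First-order stochastic dominance of the payoff follows from larger reaching probabilities. -/
theorem integral_comp_reachPayoff_le {S : Type*} [Fintype S] {P P' : Measure (Run S)}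
    [IsProbabilityMeasure P] [IsProbabilityMeasure P'] {T : Set S} {r : S → ℝ}
    (hr : ((∀ᵐ ρ ∂P, ∃ i, ρ i ∈ T) ∧ ∀ᵐ ρ ∂P', ∃ i, ρ i ∈ T) ∨ ∀ s ∈ T, 0 ≤ r s)
    (hle : ∀ t ∈ T, P.real (firstTarget T t) ≤ P'.real (firstTarget T t))
    {f : ℝ → ℝ} (hf : Monotone f) :
    ∫ ρ, f (reachPayoff T r ρ) ∂P ≤ ∫ ρ, f (reachPayoff T r ρ) ∂P' := by
  classical
  rw [integral_comp_reachPayoff, integral_comp_reachPayoff]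
  refine add_le_add le_rfl ?_
  rcases hr with ⟨h, h'⟩ | hr
  -- Both families of probabilities sum to 1, so termwise inequality forces equality and the signs
  -- of the rewards do not matter.
  · have heq := (Finset.sum_eq_sum_iff_of_le fun t ht => hle t (Finset.mem_filter.1 ht).2).1
      ((sum_firstTarget_eq_one h).trans (sum_firstTarget_eq_one h').symm)
    exact (Finset.sum_congr rfl fun t ht => by rw [heq t ht]).le
  · refine Finset.sum_le_sum fun t ht => ?_
    have ht' := (Finset.mem_filter.1 ht).2
    exact mul_le_mul_of_nonneg_right (hle t ht') (sub_nonneg.2 (hf (hr t ht')))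

/-! ### From an arbitrary to a memoryless strategy -/

namespace MDP

variable {S A : Type*} {𝓜 : MDP S A}

theorem Strategy.hasSum_visit (σ : 𝓜.Strategy) {T : Set S} {t : S} (ht : t ∈ T) :
    HasSum (fun n => σ.visit T n t) (σ.prob.real (firstTarget T t)) := by
  let visited : Run (S × σ.Mem × A) → Run S := fun ρ i => (ρ i).1
  have hm : Measurable visited := by
    let _ : MeasurableSpace S := ⊤
    exact measurable_pi_lambda _ fun i => Run.measurable_eval i Prod.fst
  let E : ℕ → Set (Run (S × σ.Mem × A)) := fun n =>
    {ρ | (∀ i, i < n → ρ i ∈ {x | x.1 ∉ T}) ∧ ρ n ∈ {x | x.1 = t}}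
  have hE : ∀ n, MeasurableSet (E n) := fun n =>
    (Run.measurableSet_forall (fun i => i < n) {x : S × σ.Mem × A | x.1 ∉ T}).inter
      (Run.measurableSet_eval n {x : S × σ.Mem × A | x.1 = t})
  have hdisj : Pairwise (Function.onFun Disjoint E) := by
    have key : ∀ m n, m < n → Disjoint (E m) (E n) := fun m n hmn =>
      Set.disjoint_left.2 fun ρ (h1 : ρ ∈ E m) (h2 : ρ ∈ E n) =>
        h2.1 m hmn ((show (ρ m).1 = t from h1.2) ▸ ht)
    intro m n hmn
    rcases lt_or_gt_of_ne hmn with h | h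
    · exact key m n h
    · exact (key n m h).symm
  have hprob : σ.prob (firstTarget T t) = ∑' n, σ.play.law (E n) := by
    have hpre : visited ⁻¹' firstTarget T t = ⋃ n, E n := Set.preimage_iUnion
    rw [← measure_iUnion hdisj hE, ← hpre]
    exact Measure.map_apply hm (measurableSet_firstTarget T t)
  rw [measureReal_def, hprob, ENNReal.tsum_toReal_eq fun n => measure_ne_top _ _]
  exact ENNReal.hasSum_toReal (hprob ▸ measure_ne_top _ _)

theorem sum_toReal_eq_one [Fintype S] (d : PMF S) : ∑ s, (d s).toReal = 1 := by
  rw [← ENNReal.toReal_sum fun s _ => d.apply_ne_top s, ← tsum_fintype (L := .unconditional S),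
    d.tsum_coe, ENNReal.toReal_one]

theorem sum_sum_owner [DecidableEq S] [Fintype A] (N : Finset S) (g : A → ℝ) :
    ∑ s ∈ N, ∑ a with 𝓜.owner a = s, g a = ∑ a with 𝓜.owner a ∈ N, g a := by
  simp only [Finset.sum_filter]
  rw [Finset.sum_comm]
  simp

open Classical Filter Topology in
/-- The reaching probabilities of any strategy are carried by a finite leaky flow. -/
theorem Strategy.exists_flow [Fintype S] [Fintype A] (σ : 𝓜.Strategy) (T : Set S) :
    ∃ y : A → ℝ, 0 ≤ y ∧
      (∀ s ∉ T, ∑ a with 𝓜.owner a = s, y a ≤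
        (if s = 𝓜.s₀ then 1 else 0) + ∑ a with 𝓜.owner a ∉ T, y a * (𝓜.Δ a s).toReal) ∧
      ∀ t ∈ T, σ.prob.real (firstTarget T t) ≤
        (if t = 𝓜.s₀ then 1 else 0) + ∑ a with 𝓜.owner a ∉ T, y a * (𝓜.Δ a t).toReal := by
  -- Outflow minus inflow off `T`, and minus the inflow on `T`: both the flow condition and the
  -- lower bounds at targets become upper bounds on `L`.
  let L : (A → ℝ) →ₗ[ℝ] (S → ℝ) :=
    { toFun := fun y s => (if s ∈ T then 0 else ∑ a with 𝓜.owner a = s, y a) -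
        ∑ a with 𝓜.owner a ∉ T, y a * (𝓜.Δ a s).toReal
      map_add' := fun y z => by
        ext s
        simp only [Pi.add_apply, add_mul, Finset.sum_add_distrib]
        split_ifs <;> ring
      map_smul' := fun c y => by
        ext s
        simp only [Pi.smul_apply, smul_eq_mul, mul_assoc, ← Finset.mul_sum, RingHom.id_apply]
        split_ifs <;> ring }
  let δ : S → ℝ := fun s => if s = 𝓜.s₀ then 1 else 0
  let y : ℕ → A → ℝ := fun n a => ∑ k ∈ Finset.range n, σ.take T k a
  have htake : ∀ k a, 0 ≤ σ.take T k a := fun _ _ => measureReal_nonneg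
  have hvisit : ∀ k s, 0 ≤ σ.visit T k s := fun _ _ => measureReal_nonneg
  have hflow : ∀ n s, δ s + ∑ a with 𝓜.owner a ∉ T, y n a * (𝓜.Δ a s).toReal =
      ∑ k ∈ Finset.range (n + 1), σ.visit T k s := fun n s => by
    rw [Finset.sum_range_succ', σ.visit_zero, add_comm]
    congr 1
    rw [Finset.sum_filter_of_ne]
    · simp only [y, Finset.sum_mul, σ.visit_succ]
      rw [Finset.sum_comm]
    · intro a _ ha hT
      exact ha (by simp [y, σ.take_eq_zero hT])
  have hlim : Tendsto (fun n s => δ s - if s ∈ T then ∑ k ∈ Finset.range (n + 1), σ.visit T k s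
      else 0) atTop (𝓝 fun s => δ s - if s ∈ T then σ.prob.real (firstTarget T s) else 0) := by
    refine tendsto_pi_nhds.2 fun s => ?_
    split_ifs with hs
    · exact tendsto_const_nhds.sub ((tendsto_add_atTop_iff_nat 1).2
        (σ.hasSum_visit hs).tendsto_sum_nat)
    · exact tendsto_const_nhds
  -- Off `T` the truncated counts leak exactly `σ.visit T n s`: the inflow includes the visit at
  -- time `n`, the outflow does not.
  have hle : ∀ n, L (y n) ≤ fun s => δ s - if s ∈ T then
      ∑ k ∈ Finset.range (n + 1), σ.visit T k s else 0 := fun n s => by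
    have h := hflow n s
    simp only [L, LinearMap.coe_mk, AddHom.coe_mk]
    split_ifs with hs
    · linarith
    · have h2 : ∑ a with 𝓜.owner a = s, y n a = ∑ k ∈ Finset.range n, σ.visit T k s := by
        simp only [y]
        rw [Finset.sum_comm]
        exact Finset.sum_congr rfl fun k _ => (σ.visit_eq_sum_take hs k).symm
      rw [Finset.sum_range_succ] at h
      linarith [hvisit n s]
  obtain ⟨y', hy', hL⟩ := L.exists_nonneg_map_le_of_tendsto
    (fun n a => Finset.sum_nonneg fun k _ => htake k a) hle hlim
  refine ⟨y', hy', fun s hs => ?_, fun t ht => ?_⟩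
  · have h := hL s
    simp only [L, LinearMap.coe_mk, AddHom.coe_mk, if_neg hs] at h
    linarith
  · have h := hL t
    simp only [L, LinearMap.coe_mk, AddHom.coe_mk, if_pos ht] at h
    linarith

/-- Some memoryless strategy reaches each target state first with at least the probability under a
given strategy. -/
theorem Strategy.exists_memoryless_le [Finite S] [Finite A] (σ : 𝓜.Strategy) (T : Set S) :
    ∃ τ : 𝓜.Strategy, τ.IsMemoryless ∧
      ∀ t ∈ T, σ.prob.real (firstTarget T t) ≤ τ.prob.real (firstTarget T t) := by
  classical
  have := Fintype.ofFinite S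
  have := Fintype.ofFinite A
  obtain ⟨y, hy, hin, hout⟩ := σ.exists_flow T
  have hne : ∀ s, (Finset.univ.filter fun a => 𝓜.owner a = s).Nonempty := fun s => by
    obtain ⟨a, ha⟩ := 𝓜.av_nonempty s
    exact ⟨a, by simpa using mem_Av_iff.1 ha⟩
  choose p hp hpy using fun s => PMF.exists_eq_sum_mul _ (hne s) y hy
  have hp' : ∀ s, (p s).support ⊆ 𝓜.Av s := fun s a ha => mem_Av_iff.2 (by simpa using hp s ha)
  let Y : S → ℝ := fun s => ∑ a with 𝓜.owner a = s, y a
  let N : Finset S := Finset.univ.filter fun s => s ∉ T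
  let P : S → S → ℝ := fun s s' =>
    ∑ a with 𝓜.owner a = s, (p s a).toReal * (𝓜.Δ a s').toReal
  have hP : ∀ s s', 0 ≤ P s s' := fun s s' =>
    Finset.sum_nonneg fun a _ => mul_nonneg ENNReal.toReal_nonneg ENNReal.toReal_nonneg
  have hrow : ∀ s ∈ N, ∑ s', P s s' ≤ 1 := fun s _ => by
    simp only [P]
    rw [Finset.sum_comm]
    simp only [← Finset.mul_sum, sum_toReal_eq_one, mul_one]
    rw [← sum_toReal_eq_one (p s)]
    exact Finset.sum_le_sum_of_subset_of_nonneg (Finset.subset_univ _)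
      fun _ _ _ => ENNReal.toReal_nonneg
  -- Used twice: for the flow `y` with its state totals `Y`, and for the actions and visits of `τ`
  -- at a fixed time.
  have hflow : ∀ (z : A → ℝ) (Z : S → ℝ),
      (∀ a, 𝓜.owner a ∉ T → z a = Z (𝓜.owner a) * (p (𝓜.owner a) a).toReal) → ∀ s',
      ∑ a with 𝓜.owner a ∉ T, z a * (𝓜.Δ a s').toReal = ∑ s ∈ N, Z s * P s s' := by
    intro z Z hz s'
    have hN : (Finset.univ.filter fun a => 𝓜.owner a ∉ T) =
        Finset.univ.filter fun a => 𝓜.owner a ∈ N := by simp [N]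
    rw [hN, ← sum_sum_owner]
    refine Finset.sum_congr rfl fun s hs => ?_
    simp only [P, Finset.mul_sum]
    refine Finset.sum_congr rfl fun a ha => ?_
    obtain rfl : 𝓜.owner a = s := by simpa using ha
    rw [hz a (by simpa [N] using hs), mul_assoc]
  have hyY := hflow y Y fun a _ => hpy _ a (by simp)
  let τ := memoryless p hp'
  refine ⟨τ, isMemoryless_memoryless p hp', fun t ht => ?_⟩
  have hν : ∀ n s', τ.visit T (n + 1) s' = ∑ s ∈ N, τ.visit T n s * P s s' := fun n s' => by
    rw [← hflow (τ.take T n) _ fun a ha => take_memoryless p hp' ha n, τ.visit_succ,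
      Finset.sum_filter_of_ne]
    exact fun a _ ha hT => ha (by rw [τ.take_eq_zero hT, zero_mul])
  have h := flow_le_of_sum_le (Y := Y) (t := t) hP hrow (by simpa [N] using ht) hν
    (fun s' hs' => by
      rw [τ.visit_zero, ← hyY]
      exact hin s' (by simpa [N] using hs'))
    fun n => sum_le_hasSum _ (fun k _ => measureReal_nonneg) (τ.hasSum_visit ht)
  rw [τ.visit_zero, ← hyY] at h
  exact (hout t ht).trans h

end MDP

theorem mainTheorem6 {S A : Type*} [Finite S] [Finite A] (𝓜 : MDP S A) (Q : ReachQuery S)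
    (hattr : 𝓜.Attraction Q.T Q.r) (hsat : ∃ σ : 𝓜.Strategy, σ.IsWitness Q) :
    ∃ σ : 𝓜.Strategy, σ.IsMemoryless ∧ σ.IsWitness Q := by
  have := Fintype.ofFinite S
  obtain ⟨σ, he, hc, hv⟩ := hsat
  obtain ⟨τ, hτ, hle⟩ := σ.exists_memoryless_le Q.T
  -- Attraction quantifies over all strategies, so its almost sure case also covers `τ`.
  have hdom : ∀ f : ℝ → ℝ, Monotone f → ∫ ρ, f (reachPayoff Q.T Q.r ρ) ∂σ.prob ≤
      ∫ ρ, f (reachPayoff Q.T Q.r ρ) ∂τ.prob := fun f hf =>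
    integral_comp_reachPayoff_le (hattr.imp_left fun h => ⟨h σ, h τ⟩) hle hf
  have hm := measurable_reachPayoff Q.T Q.r
  have hb := abs_reachPayoff_le Q.T Q.r
  exact ⟨τ, hτ, he.trans (WithBot.coe_le_coe.2 (hdom id monotone_id)),
    hc.trans (WithBot.coe_le_coe.2 (CVaR_mono hm hm hb hb Q.p_mem.1 Q.p_mem.2 hdom)),
    hv.trans (WithBot.coe_le_coe.2 (VaR_mono hm hm hb hb Q.q_mem.1 Q.q_mem.2 hdom))⟩
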